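/- Let $k\ge 1$ be an integer. Let $T_k$ be the $(k+1)$-regular tree (every vertex has degree $k+1$), and let $T_k^*$ be the rooted $(k+1)$-tree, that is, the tree in which one vertex, the root $v_0$, has degree $k$ and every other vertex has degree $k+1$. Blocking RSA (random sequential adsorption with nearest-neighbour blocking) on a finite graph with vertex set $W$ is the following process: the arrival times $(\tau_v)_{v\in W}$ are independent and uniformly distributed on $(0,1)$; all sites are initially vacant; site $v$ becomes occupied at time $\tau_v$ if none of its neighbours is already occupied, and otherwise the particle arriving at $v$ is rejected; occupied sites remain occupied. Let $X^W_t(v)\in\{0,1\}$ be the state of $v$ at time $t$ ($1$ is occupied, $0$ is vacant). On an infinite graph with vertex set $V$ and independent arrival times $(\tau_v)_{v\in V}$, uniformly distributed on $(0,1)$, put $X^V_t(v)=\lim_{n}X^{V_n}_t(v)$ for finite sets $V_n\subset V$, carrying the induced graph structure, with $\bigcup_{n}\bigcap_{m\ge n}V_m=V$. For $V=T_k$ and for $V=T_k^*$, almost surely this limit exists for all $v$, all $t$ and all such sequences $(V_n)$, and does not depend on the sequence. For every $t\in[0,1]$ and every vertex $v$ of $T_k$, $$P[X^{T_k}_t(v)=0]=\tfrac12\Bigl(1+\bigl(P[X^{T_k^*}_t(v_0)=0]\bigr)^2\Bigr),$$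 where $$P[X^{T_k^*}_t(v_0)=0]=\begin{cases}(1+(k-1)t)^{-1/(k-1)}, & k\ge 2,\\ e^{-t}, & k=1.\end{cases}$$ In particular, for every vertex $v$ of $T_k$, $$P[X^{T_k}_1(v)=0]=\begin{cases}\tfrac12\bigl(1+k^{-2/(k-1)}\bigr), & k\ge 2,\\ \tfrac12\bigl(1+e^{-2}\bigr), & k=1.\end{cases}$$ -/

import Mathlib

open MeasureTheory ProbabilityTheory Filter Topology

namespace BlockingRSA

/-- `G` is the `(k+1)`-regular tree `T_k` (Bethe lattice): a tree, i.e. connected and without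
cycles, in which every vertex has degree `k + 1`. -/
structure IsRegularTree {V : Type*} (k : ℕ) (G : SimpleGraph V) [G.LocallyFinite] : Prop where
  isTree : G.IsTree
  regular : G.IsRegularOfDegree (k + 1)

/-- `H` is the rooted `(k+1)`-tree `T_k^*` with root `r`: a tree in which `r` has degree `k` and
every other vertex has degree `k + 1`. -/
structure IsRootedRegularTree {U : Type*} (k : ℕ) (H : SimpleGraph U) [H.LocallyFinite]
    (r : U) : Prop where
  isTree : H.IsTree
  degree_root : H.degree r = k
  degree_of_ne : ∀ u, u ≠ r → H.degree u = k + 1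

/-- The arrival times: independent random variables, each uniformly distributed on `(0, 1)`. -/
structure IsArrivalTimes {V Ω : Type*} [MeasurableSpace Ω] (P : Measure Ω) (τ : V → Ω → ℝ) :
    Prop where
  measurable : ∀ v, Measurable (τ v)
  uniform : ∀ v, pdf.IsUniform (τ v) (Set.Ioo 0 1) P volume
  indep : iIndepFun τ P

/-- The particle arriving at `v` is accepted, in blocking RSA on the subgraph of `G` induced by the
finite vertex set `W`, when `τ` lists the arrival times: `v` is a site of `W`, and no neighbour of
`v` in `W` whose particle arrived earlier accepted it. -/
def Accepted {V : Type*} (G : SimpleGraph V) (W : Finset V) (τ : V → ℝ) (v : V) : Prop :=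
  v ∈ W ∧ ∀ w, w ∈ W → G.Adj v w → τ w < τ v → ¬ Accepted G W τ w
termination_by {w ∈ W | τ w < τ v}.card
decreasing_by
  rename_i hw _ hlt
  refine Finset.card_lt_card ⟨fun x hx => ?_, fun hsub => ?_⟩
  · rw [Finset.mem_filter] at hx ⊢
    exact ⟨hx.1, hx.2.trans hlt⟩
  · exact lt_irrefl _ (Finset.mem_filter.1 (hsub (Finset.mem_filter.2 ⟨hw, hlt⟩))).2

open Classical in
/-- The state `X_t^W(v)` of site `v` at time `t` for blocking RSA on the subgraph of `G` induced by
the finite vertex set `W` (`1` is occupied, `0` is vacant). -/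
noncomputable def finiteState {V : Type*} (G : SimpleGraph V) (W : Finset V) (τ : V → ℝ) (t : ℝ)
    (v : V) : Fin 2 :=
  if Accepted G W τ v ∧ τ v ≤ t then 1 else 0

/-- The dynamics of blocking RSA on a finite vertex set: a site is occupied at time `t` if and only
if its particle has arrived by time `t` and found no neighbour already occupied. -/
theorem finiteState_eq_one_iff {V : Type*} (G : SimpleGraph V) (W : Finset V) (τ : V → ℝ) (t : ℝ)
    (v : V) :
    finiteState G W τ t v = 1 ↔
      v ∈ W ∧ τ v ≤ t ∧ ∀ w ∈ W, G.Adj v w → ∀ s < τ v, finiteState G W τ s w = 0 := by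
  unfold finiteState
  rw [Accepted]
  constructor
  · intro h
    have h' : (v ∈ W ∧ ∀ w, w ∈ W → G.Adj v w → τ w < τ v → ¬ Accepted G W τ w) ∧ τ v ≤ t := by
      by_contra hc
      simp [hc] at h
    refine ⟨h'.1.1, h'.2, fun w hw hvw s hs => if_neg fun hc => ?_⟩
    exact h'.1.2 w hw hvw (hc.2.trans_lt hs) hc.1
  · rintro ⟨hv, ht, h⟩
    refine if_pos ⟨⟨hv, fun w hw hvw hlt hacc => ?_⟩, ht⟩
    have := h w hw hvw (τ w) hlt
    simp [hacc] at this

/-- The state `X_t^V(v)` of site `v` at time `t` for blocking RSA on the whole, possibly infinite,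
graph `G`: the limit of `X_t^W(v)` as the finite vertex set `W` increases to all of `V`. -/
noncomputable def state {V : Type*} (G : SimpleGraph V) (τ : V → ℝ) (t : ℝ) (v : V) : Fin 2 :=
  limUnder (atTop : Filter (Finset V)) fun W => finiteState G W τ t v

/-- Blocking RSA on `G` is well defined for the arrival times `τ`: for all sites `v` and times `t`
and every sequence of finite vertex sets `W 0, W 1, …` with `liminf W n = V`, the states
`X_t^{W n}(v)` converge to `X_t^V(v)`. -/
def IsWellDefined {V : Type*} (G : SimpleGraph V) (τ : V → ℝ) : Prop :=
  ∀ (v : V) (t : ℝ), ∀ W : ℕ → Finset V,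
    (⋃ n, ⋂ m, ⋂ _ : n ≤ m, (W m : Set V)) = Set.univ →
      Tendsto (fun n => finiteState G (W n) τ t v) atTop (𝓝 (state G τ t v))

/-- The probability `P[X_t^V(v) = 0]` that site `v` is vacant at time `t`. -/
noncomputable def vacancyProb {V Ω : Type*} [MeasurableSpace Ω] (G : SimpleGraph V)
    (P : Measure Ω) (τ : V → Ω → ℝ) (t : ℝ) (v : V) : ℝ :=
  P.real {ω | state G (fun w => τ w ω) t v = 0}

end BlockingRSA

/-!
The proof avoids comparing different copies of the rooted tree: everything is computed inside the
given tree `G`, seen from a vertex `o` chosen as its root.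

*Well-definedness.* Call `w` a predecessor of `v` if it is a neighbour of `v` whose particle arrives
earlier. If the predecessor relation is well-founded, then, as the graph is locally finite, the fate
of each site is decided by finitely many sites, so acceptance is eventually constant as the finite
vertex set grows (`eventually_accepted_iff`), and `isWellDefined_of_wellFounded` follows. The
relation is almost surely well-founded (`IsArrivalTimes.ae_wellFounded`): along an infinite
descending path the arrival times converge, so from some vertex on they stay in an interval of
length `1 / (2 (d + 1))`, where `d` bounds the degrees; but there are at most `d ^ n` walks with `n`
steps from a vertex, and each is self-avoiding with all its arrival times in the interval with
probability at most `(2 (d + 1)) ^ (-n)`.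

*Recursion.* A site `w` can only be blocked by sites that arrive before it, so if the parent of `w`
arrives after `w`, acceptance at `w` depends only on the branch of descendants of `w`. Let
`occTime n w` be the time at which `w` becomes occupied when the process runs on the first `n`
generations of that branch. The branches at the children of `w` are disjoint, hence independent of
each other and of the arrival time at `w`, and conditioning on the latter gives
`P[t ≤ occTime (n + 1) w] = 1 - ∫₀ᵗ ∏ₓ P[s ≤ occTime n x] ds`, the product being over the children
(`IsArrivalTimes.measureReal_le_occTime_succ`). As every vertex but the root has `k` children, its
vacancy probabilities are the Picard iterates of `h t = 1 - ∫₀ᵗ h ^ k`, which converge to the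
explicit solution `rootVacancy k`. Hence the root, of degree `d`, is vacant at time `t` with
probability `1 - ∫₀ᵗ h ^ d` (`IsArrivalTimes.vacancyProb_eq`). For `d = k` this is `h t`; for
`d = k + 1` it is `(1 + h t ^ 2) / 2`, since `(h ^ 2)' = -2 h ^ (k + 1)`.
-/

namespace BlockingRSA

/-! ### Branches of a rooted tree -/

section Tree

variable {V : Type*} {G : SimpleGraph V}

/-- In a tree, geodesics are unique: a geodesic from `o` to `y` meets each sphere around `o` in one
point. -/
theorem eq_of_dist_eq_add (hG : G.IsTree) {o x x' y : V}
    (h : G.dist o y = G.dist o x + G.dist x y) (h' : G.dist o y = G.dist o x' + G.dist x' y)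
    (hd : G.dist o x = G.dist o x') : x = x' := by
  obtain ⟨a, ha⟩ := hG.connected.exists_walk_length_eq_dist o x
  obtain ⟨b, hb⟩ := hG.connected.exists_walk_length_eq_dist x y
  obtain ⟨a', ha'⟩ := hG.connected.exists_walk_length_eq_dist o x'
  obtain ⟨b', hb'⟩ := hG.connected.exists_walk_length_eq_dist x' y
  have hp : (a.append b).IsPath := SimpleGraph.Walk.isPath_of_length_eq_dist _ (by simp; omega)
  have hp' : (a'.append b').IsPath := SimpleGraph.Walk.isPath_of_length_eq_dist _ (by simp; omega)
  have heq := (hG.existsUnique_path o y).unique hp hp'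
  have h1 : (a.append b).getVert a.length = x := by simp [SimpleGraph.Walk.getVert_append]
  have h2 : (a'.append b').getVert a'.length = x' := by simp [SimpleGraph.Walk.getVert_append]
  rw [← h1, ← h2, heq, ha, ha', hd]

/-- The branch of the tree `G`, rooted at `o`, that hangs at `w`: the descendants of `w`, `w`
included, i.e. the vertices `y` for which `w` lies on the geodesic from `o` to `y`. -/
def branch (G : SimpleGraph V) (o w : V) : Set V :=
  {y | G.dist o y = G.dist o w + G.dist w y}

theorem self_mem_branch (o w : V) : w ∈ branch G o w := by simp [branch]

variable [G.LocallyFinite]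

open Classical in
/-- The children of `w` in the tree `G` rooted at `o`: the neighbours of `w` that are farther from
`o` than `w`. -/
noncomputable def children (G : SimpleGraph V) [G.LocallyFinite] (o w : V) : Finset V :=
  {x ∈ G.neighborFinset w | G.dist o x = G.dist o w + 1}

theorem mem_children {o w x : V} :
    x ∈ children G o w ↔ G.Adj w x ∧ G.dist o x = G.dist o w + 1 := by
  simp [children]

theorem branch_subset_of_mem_children (hG : G.IsTree) {o w x : V} (hx : x ∈ children G o w) :
    branch G o x ⊆ branch G o w := by
  intro y hy
  obtain ⟨hadj, hd⟩ := mem_children.1 hx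
  have h1 := hG.connected.dist_triangle (u := o) (v := w) (w := y)
  have h2 := hG.connected.dist_triangle (u := w) (v := x) (w := y)
  have h3 := SimpleGraph.dist_eq_one_iff_adj.2 hadj
  simp only [branch, Set.mem_ofPred_eq] at hy ⊢
  omega

theorem notMem_branch_of_mem_children {o w x : V} (hx : x ∈ children G o w) :
    w ∉ branch G o x := by
  have := (mem_children.1 hx).2
  simp only [branch, Set.mem_ofPred_eq]
  omega

theorem disjoint_branch (hG : G.IsTree) {o w x x' : V} (hx : x ∈ children G o w)
    (hx' : x' ∈ children G o w) (hne : x ≠ x') : Disjoint (branch G o x) (branch G o x') := by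
  rw [Set.disjoint_left]
  intro y hy hy'
  exact hne (eq_of_dist_eq_add hG hy hy'
    ((mem_children.1 hx).2.trans (mem_children.1 hx').2.symm))

/-- The parent of a vertex is unique. -/
theorem eq_of_mem_children (hG : G.IsTree) {o w x y : V} (hx : x ∈ children G o w)
    (hy : G.Adj x y) (hyc : y ∉ children G o x) : y = w := by
  obtain ⟨hadj, hd⟩ := mem_children.1 hx
  have hyd : G.dist o x = G.dist o y + 1 := by
    rcases hG.dist_eq_dist_add_one_of_adj o hy with h | h
    · exact h
    · exact absurd (mem_children.2 ⟨hy, h⟩) hyc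
  refine eq_of_dist_eq_add hG (o := o) (y := x) ?_ ?_ (by omega)
  · rw [SimpleGraph.dist_eq_one_iff_adj.2 hy.symm, hyd]
  · rw [SimpleGraph.dist_eq_one_iff_adj.2 hadj, hd]

theorem children_root (o : V) : children G o o = G.neighborFinset o := by
  ext x
  simp only [mem_children, SimpleGraph.dist_self, zero_add, SimpleGraph.mem_neighborFinset,
    and_iff_left_iff_imp]
  exact SimpleGraph.dist_eq_one_iff_adj.2

/-- Every vertex other than the root has exactly one neighbour that is not a child. -/
theorem card_children_add_one (hG : G.IsTree) {o w : V} (hw : w ≠ o) :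
    (children G o w).card + 1 = G.degree w := by
  classical
  obtain ⟨p, hp⟩ := hG.connected.exists_walk_length_eq_dist w o
  have hparent : ∃ u, G.Adj w u ∧ w ∈ children G o u := by
    cases p with
    | nil => exact absurd rfl hw
    | @cons _ u _ hadj q =>
      refine ⟨u, hadj, mem_children.2 ⟨hadj.symm, ?_⟩⟩
      have h1 := SimpleGraph.dist_le q
      simp only [SimpleGraph.Walk.length_cons] at hp
      rw [SimpleGraph.dist_comm (u := w)] at hp
      rw [SimpleGraph.dist_comm (u := u)] at h1
      rcases hG.dist_eq_dist_add_one_of_adj o hadj with h | h <;> omega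
  obtain ⟨u, hadj, hu⟩ := hparent
  have hnot : u ∉ children G o w := fun h => by
    have h1 := (mem_children.1 h).2
    have h2 := (mem_children.1 hu).2
    omega
  have hins : G.neighborFinset w = insert u (children G o w) := by
    ext y
    rw [SimpleGraph.mem_neighborFinset, Finset.mem_insert]
    constructor
    · intro hy
      by_cases hc : y ∈ children G o w
      · exact Or.inr hc
      · exact Or.inl (eq_of_mem_children hG hu hy hc)
    · rintro (rfl | h)
      · exact hadj
      · exact (mem_children.1 h).1
  rw [← SimpleGraph.card_neighborFinset_eq_degree, hins, Finset.card_insert_of_notMem hnot]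

end Tree

/-! ### Blocking RSA on the whole graph -/

section Limit

variable {V : Type*} {G : SimpleGraph V}

/-- `w` is a neighbour of `v` whose particle arrives before that of `v`. -/
def Precedes (G : SimpleGraph V) (τ : V → ℝ) (w v : V) : Prop := G.Adj v w ∧ τ w < τ v

/-- The particle arriving at `v` is accepted on every large enough finite vertex set: acceptance
in blocking RSA on the whole graph. -/
def LimitAccepted (G : SimpleGraph V) (τ : V → ℝ) (v : V) : Prop :=
  ∀ᶠ W : Finset V in atTop, Accepted G W τ v

/-- If the fate of each predecessor of `v` is eventually constant, so is the fate of `v`. -/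
theorem eventually_accepted_iff_forall [G.LocallyFinite] {τ : V → ℝ} {v : V} {A : V → Prop}
    (h : ∀ w, Precedes G τ w v → ∀ᶠ W : Finset V in atTop, (Accepted G W τ w ↔ A w)) :
    ∀ᶠ W : Finset V in atTop, (Accepted G W τ v ↔ ∀ w, Precedes G τ w v → ¬ A w) := by
  classical
  have hall : ∀ᶠ W : Finset V in atTop, ∀ w ∈ G.neighborFinset v,
      Precedes G τ w v → (Accepted G W τ w ↔ A w) := by
    rw [Filter.eventually_all_finset]
    intro w _
    by_cases hw : Precedes G τ w v
    · filter_upwards [h w hw] with W hW _ using hW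
    · exact Eventually.of_forall fun W hc => absurd hc hw
  filter_upwards [hall, eventually_ge_atTop (insert v (G.neighborFinset v))] with W hW hsub
  rw [Accepted]
  constructor
  · rintro ⟨-, hacc⟩ w hw
    have hwn : w ∈ G.neighborFinset v := (G.mem_neighborFinset v w).2 hw.1
    rw [← hW w hwn hw]
    exact hacc w (hsub (Finset.mem_insert_of_mem hwn)) hw.1 hw.2
  · intro hacc
    refine ⟨hsub (Finset.mem_insert_self _ _), fun w _ hadj hlt => ?_⟩
    rw [hW w ((G.mem_neighborFinset v w).2 hadj) ⟨hadj, hlt⟩]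
    exact hacc w ⟨hadj, hlt⟩

theorem eventually_accepted_iff [G.LocallyFinite] {τ : V → ℝ} (hwf : WellFounded (Precedes G τ))
    (v : V) : ∀ᶠ W : Finset V in atTop, (Accepted G W τ v ↔ LimitAccepted G τ v) := by
  induction v using hwf.induction with
  | _ v ih =>
    have h := eventually_accepted_iff_forall ih
    have hv : LimitAccepted G τ v ↔ ∀ w, Precedes G τ w v → ¬ LimitAccepted G τ w := by
      rw [LimitAccepted, eventually_congr h, eventually_const]
    filter_upwards [h] with W hW
    rw [hW, hv]

theorem limitAccepted_iff [G.LocallyFinite] {τ : V → ℝ} (hwf : WellFounded (Precedes G τ))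
    (v : V) : LimitAccepted G τ v ↔ ∀ w, Precedes G τ w v → ¬ LimitAccepted G τ w := by
  have h := eventually_accepted_iff_forall (v := v)
    fun w _ => eventually_accepted_iff hwf w
  rw [LimitAccepted, eventually_congr h, eventually_const]

open Classical in
theorem tendsto_finiteState [G.LocallyFinite] {τ : V → ℝ} (hwf : WellFounded (Precedes G τ))
    (t : ℝ) (v : V) :
    Tendsto (fun W : Finset V => finiteState G W τ t v) atTop
      (𝓝 (if LimitAccepted G τ v ∧ τ v ≤ t then 1 else 0)) := by
  refine tendsto_const_nhds.congr' ?_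
  filter_upwards [eventually_accepted_iff hwf v] with W hW
  simp only [finiteState, hW]

open Classical in
theorem state_eq [G.LocallyFinite] {τ : V → ℝ} (hwf : WellFounded (Precedes G τ))
    (t : ℝ) (v : V) : state G τ t v = if LimitAccepted G τ v ∧ τ v ≤ t then 1 else 0 :=
  (tendsto_finiteState hwf t v).limUnder_eq

theorem isWellDefined_of_wellFounded [G.LocallyFinite] {τ : V → ℝ}
    (hwf : WellFounded (Precedes G τ)) : IsWellDefined G τ := by
  intro v t W hW
  have hlim : Tendsto W atTop atTop := by
    rw [tendsto_atTop]
    intro D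
    have hD : ∀ᶠ n in atTop, ∀ x ∈ D, x ∈ W n := by
      rw [Filter.eventually_all_finset]
      intro x _
      have hx : x ∈ ⋃ n, ⋂ m, ⋂ _ : n ≤ m, (W m : Set V) := hW ▸ Set.mem_univ x
      simp only [Set.mem_iUnion, Set.mem_iInter] at hx
      obtain ⟨n, hn⟩ := hx
      filter_upwards [eventually_ge_atTop n] with m hm using hn m hm
    filter_upwards [hD] with n hn using hn
  rw [state_eq hwf]
  exact (tendsto_finiteState hwf t v).comp hlim

end Limit

/-! ### Occupation times inside a branch -/

section OccupationTime

variable {V : Type*} {G : SimpleGraph V} [G.LocallyFinite]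

open Classical in
/-- The time at which `w` becomes occupied in blocking RSA on the first `n` generations of the
branch at `w` of the tree `G` rooted at `o`. The value `2`, beyond the range of the arrival times,
means that the particle arriving at `w` is rejected (or that `n = 0`, so that `w` is not there). As
in `Accepted`, only particles that arrive strictly earlier can block. -/
noncomputable def occTime (G : SimpleGraph V) [G.LocallyFinite] (o : V) (τ : V → ℝ) :
    ℕ → V → ℝ
  | 0, _ => 2
  | n + 1, w => if ∀ x ∈ children G o w, τ w ≤ occTime G o τ n x then τ w else 2

theorem occTime_eq_or {o : V} {τ : V → ℝ} (n : ℕ) (w : V) :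
    occTime G o τ n w = τ w ∨ occTime G o τ n w = 2 := by
  cases n with
  | zero => exact Or.inr rfl
  | succ n =>
    rw [occTime]
    split_ifs
    · exact Or.inl rfl
    · exact Or.inr rfl

open Classical in
/-- A vertex `w` whose parent arrives later cannot be blocked by it, so acceptance at `w` on the
whole tree is decided inside the branch at `w`. -/
theorem eventually_occTime_eq (hG : G.IsTree) {o : V} {τ : V → ℝ}
    (hwf : WellFounded (Precedes G τ)) (h2 : ∀ v, τ v < 2) (w : V)
    (hw : ∀ x, Precedes G τ x w → x ∈ children G o w) :
    ∀ᶠ n in atTop, occTime G o τ n w = if LimitAccepted G τ w then τ w else 2 := by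
  induction w using hwf.induction with
  | _ w ih =>
    have hall : ∀ᶠ n in atTop, ∀ x ∈ children G o w, Precedes G τ x w →
        occTime G o τ n x = if LimitAccepted G τ x then τ x else 2 := by
      rw [Filter.eventually_all_finset]
      intro x hx
      by_cases hxw : Precedes G τ x w
      · -- The only neighbour of `x` that is not its child is `w`, which arrives after `x`.
        filter_upwards [ih x hxw fun y hy => by
          by_contra hc
          obtain rfl := eq_of_mem_children hG hx hy.1 hc
          exact lt_asymm hxw.2 hy.2] with n hn _ using hn
      · exact Eventually.of_forall fun n hc => absurd hc hxw
    rw [← map_add_atTop_eq_nat 1, eventually_map]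
    filter_upwards [hall] with n hn
    rw [occTime]
    congr 1
    rw [limitAccepted_iff hwf, eq_iff_iff]
    constructor
    · intro h x hx hacc
      have hxc := hw x hx
      have := h x hxc
      rw [hn x hxc hx, if_pos hacc] at this
      exact absurd hx.2 (not_lt.2 this)
    · intro h x hxc
      by_cases hlt : τ x < τ w
      · have hx : Precedes G τ x w := ⟨(mem_children.1 hxc).1, hlt⟩
        rw [hn x hxc hx, if_neg (h x hx)]
        exact (h2 w).le
      · rcases occTime_eq_or (G := G) (o := o) (τ := τ) n x with h | h
        · rw [h]; exact not_lt.1 hlt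
        · rw [h]; exact (h2 w).le

open Classical in
theorem eventually_le_occTime_iff (hG : G.IsTree) {o : V} {τ : V → ℝ}
    (hwf : WellFounded (Precedes G τ)) (h2 : ∀ v, τ v < 2) {t : ℝ} (ht : t ≤ 1)
    (hne : τ o ≠ t) : ∀ᶠ n in atTop, (t ≤ occTime G o τ n o ↔ state G τ t o = 0) := by
  have hroot : ∀ x, Precedes G τ x o → x ∈ children G o o := fun x hx => by
    rw [children_root]; exact (G.mem_neighborFinset o x).2 hx.1
  filter_upwards [eventually_occTime_eq hG hwf h2 o hroot] with n hn
  rw [hn, state_eq hwf]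
  -- If `o` is rejected, the value `2` of the occupation time exceeds `t ≤ 1`.
  by_cases hacc : LimitAccepted G τ o
  · rcases lt_or_gt_of_ne hne with h | h
    · simp [hacc, h.le, h]
    · simp [hacc, h.le, h]
  · simp only [hacc, if_false, false_and]
    simp only [iff_true]
    linarith

end OccupationTime

/-! ### The law of the arrival times -/

section ArrivalTimes

variable {V Ω : Type*} [MeasurableSpace Ω] {P : Measure Ω} {τ : V → Ω → ℝ}

theorem IsArrivalTimes.map_eq (hτ : IsArrivalTimes P τ) (v : V) :
    P.map (τ v) = volume.restrict (Set.Ioo 0 1) := by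
  have h : P.map (τ v) = ProbabilityTheory.cond volume (Set.Ioo 0 1) := hτ.uniform v
  rw [h, ProbabilityTheory.cond]
  simp

theorem IsArrivalTimes.ae_mem_Ioo [Countable V] (hτ : IsArrivalTimes P τ) :
    ∀ᵐ ω ∂P, ∀ v, τ v ω ∈ Set.Ioo (0 : ℝ) 1 := by
  rw [ae_all_iff]
  intro v
  refine ae_of_ae_map (p := fun x => x ∈ Set.Ioo (0 : ℝ) 1) (hτ.measurable v).aemeasurable ?_
  rw [hτ.map_eq]
  exact ae_restrict_mem measurableSet_Ioo

theorem IsArrivalTimes.ae_ne (hτ : IsArrivalTimes P τ) (v : V) (t : ℝ) :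
    ∀ᵐ ω ∂P, τ v ω ≠ t := by
  refine ae_of_ae_map (p := fun x => x ≠ t) (hτ.measurable v).aemeasurable ?_
  rw [hτ.map_eq]
  exact ae_restrict_of_ae (Measure.ae_ne volume t)

theorem IsArrivalTimes.measure_preimage_le (hτ : IsArrivalTimes P τ) (v : V) {I : Set ℝ}
    (hI : MeasurableSet I) : P (τ v ⁻¹' I) ≤ volume I := by
  rw [← Measure.map_apply (hτ.measurable v) hI, hτ.map_eq]
  exact Measure.restrict_apply_le _ _

end ArrivalTimes

/-! ### Almost sure absence of infinite descending paths -/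

section WellFounded

variable {V : Type*} {G : SimpleGraph V} [G.LocallyFinite]

open Classical in
/-- The vertex lists of the walks with `n` steps starting at `v`. -/
noncomputable def walkLists (G : SimpleGraph V) [G.LocallyFinite] : ℕ → V → Finset (List V)
  | 0, v => {[v]}
  | n + 1, v => (G.neighborFinset v).biUnion fun w => (walkLists G n w).image (List.cons v)

theorem card_walkLists_le {d : ℕ} (hd : ∀ v, G.degree v ≤ d) (n : ℕ) (v : V) :
    (walkLists G n v).card ≤ d ^ n := by
  classical
  induction n generalizing v with
  | zero => simp [walkLists]
  | succ n ih =>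
    rw [walkLists, pow_succ']
    refine (Finset.card_biUnion_le_card_mul _ _ (d ^ n) fun w _ =>
      Finset.card_image_le.trans (ih w)).trans ?_
    exact Nat.mul_le_mul_right _ (by simpa using hd v)

theorem length_of_mem_walkLists {n : ℕ} {v : V} {l : List V} (hl : l ∈ walkLists G n v) :
    l.length = n + 1 := by
  induction n generalizing v l with
  | zero =>
    rw [walkLists, Finset.mem_singleton] at hl
    simp [hl]
  | succ n ih =>
    simp only [walkLists, Finset.mem_biUnion, Finset.mem_image] at hl
    obtain ⟨w, _, l', hl', rfl⟩ := hl
    simp [ih hl']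

/-- An infinite path contains self-avoiding walks of every length from each of its vertices. -/
theorem exists_mem_walkLists {f : ℕ → V} (hf : Function.Injective f)
    (hadj : ∀ i, G.Adj (f i) (f (i + 1))) (n m : ℕ) :
    ∃ l ∈ walkLists G n (f m), l.Nodup ∧ ∀ y ∈ l, ∃ i ≥ m, f i = y := by
  classical
  induction n generalizing m with
  | zero => exact ⟨[f m], by simp [walkLists], by simp, fun y hy => ⟨m, le_rfl, by simp_all⟩⟩
  | succ n ih =>
    obtain ⟨l, hl, hnd, hmem⟩ := ih (m + 1)
    refine ⟨f m :: l, ?_, ?_, ?_⟩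
    · simp only [walkLists, Finset.mem_biUnion, Finset.mem_image]
      exact ⟨f (m + 1), (G.mem_neighborFinset _ _).2 (hadj m), l, hl, rfl⟩
    · refine List.nodup_cons.2 ⟨fun h => ?_, hnd⟩
      obtain ⟨i, hi, hfi⟩ := hmem _ h
      have := hf hfi
      omega
    · intro y hy
      rcases List.mem_cons.1 hy with rfl | hy
      · exact ⟨m, le_rfl, rfl⟩
      · obtain ⟨i, hi, hfi⟩ := hmem y hy
        exact ⟨i, by omega, hfi⟩

variable {Ω : Type*} [MeasurableSpace Ω] {P : Measure Ω} {τ : V → Ω → ℝ}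

theorem IsArrivalTimes.measure_forall_mem_le (hτ : IsArrivalTimes P τ) {l : List V}
    (hl : l.Nodup) {I : Set ℝ} (hI : MeasurableSet I) :
    P {ω | ∀ y ∈ l, τ y ω ∈ I} ≤ volume I ^ l.length := by
  classical
  have hset : {ω | ∀ y ∈ l, τ y ω ∈ I} = ⋂ y ∈ l.toFinset, τ y ⁻¹' I := by
    ext ω
    simp
  rw [hset, hτ.indep.measure_inter_preimage_eq_mul l.toFinset (fun _ _ => hI),
    ← List.toFinset_card_of_nodup hl]
  exact Finset.prod_le_pow_card _ _ _ fun y _ => hτ.measure_preimage_le y hI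

/-- On a graph of degree at most `d`, there are almost surely no arbitrarily long self-avoiding walks
from `v` whose arrival times all lie in a given set of measure `1 / (2 (d + 1))`: the expected number
of those with `n` steps is at most `(d / (2 (d + 1))) ^ n`. -/
theorem IsArrivalTimes.ae_exists_forall_walkLists (hτ : IsArrivalTimes P τ) {d : ℕ}
    (hd : ∀ v, G.degree v ≤ d) (v : V) {I : Set ℝ} (hI : MeasurableSet I)
    (hvol : volume I = ((2 * (d + 1) : ℕ) : ENNReal)⁻¹) :
    ∀ᵐ ω ∂P, ∃ n, ∀ l ∈ walkLists G n v, l.Nodup → ¬ ∀ y ∈ l, τ y ω ∈ I := by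
  classical
  have hbound : ∀ n, P {ω | ∃ l ∈ walkLists G n v, l.Nodup ∧ ∀ y ∈ l, τ y ω ∈ I} ≤
      (2⁻¹ : ENNReal) ^ n := by
    intro n
    have hsub : {ω | ∃ l ∈ walkLists G n v, l.Nodup ∧ ∀ y ∈ l, τ y ω ∈ I} ⊆
        ⋃ l ∈ {l ∈ walkLists G n v | l.Nodup}, {ω | ∀ y ∈ l, τ y ω ∈ I} := by
      rintro ω ⟨l, hl, hnd, h⟩
      simp only [Set.mem_iUnion]
      exact ⟨l, Finset.mem_filter.2 ⟨hl, hnd⟩, h⟩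
    have hle : (d : ENNReal) * ((2 * (d + 1) : ℕ) : ENNReal)⁻¹ ≤ 2⁻¹ := by
      rw [← div_eq_mul_inv]
      refine ENNReal.div_le_of_le_mul ?_
      push_cast
      rw [← mul_assoc, ENNReal.inv_mul_cancel (by simp) (by simp), one_mul]
      exact le_self_add
    have hle1 : ((2 * (d + 1) : ℕ) : ENNReal)⁻¹ ≤ 1 := by
      rw [ENNReal.inv_le_one]
      exact_mod_cast (by omega : 1 ≤ 2 * (d + 1))
    calc _ ≤ P (⋃ l ∈ {l ∈ walkLists G n v | l.Nodup}, {ω | ∀ y ∈ l, τ y ω ∈ I}) :=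
          measure_mono hsub
      _ ≤ ∑ l ∈ {l ∈ walkLists G n v | l.Nodup}, P {ω | ∀ y ∈ l, τ y ω ∈ I} :=
          measure_biUnion_finset_le _ _
      _ ≤ ∑ l ∈ {l ∈ walkLists G n v | l.Nodup}, ((2 * (d + 1) : ℕ) : ENNReal)⁻¹ ^ n := by
          refine Finset.sum_le_sum fun l hl => ?_
          obtain ⟨hl, hnd⟩ := Finset.mem_filter.1 hl
          refine (hτ.measure_forall_mem_le hnd hI).trans ?_
          rw [length_of_mem_walkLists hl, hvol]
          exact pow_le_pow_right_of_le_one' hle1 n.le_succ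
      _ = (({l ∈ walkLists G n v | l.Nodup}.card : ℕ) : ENNReal) *
            ((2 * (d + 1) : ℕ) : ENNReal)⁻¹ ^ n := by rw [Finset.sum_const, nsmul_eq_mul]
      _ ≤ (d : ENNReal) ^ n * ((2 * (d + 1) : ℕ) : ENNReal)⁻¹ ^ n := by
          gcongr
          exact_mod_cast (Finset.card_filter_le _ _).trans (card_walkLists_le hd n v)
      _ ≤ _ := by
          rw [← mul_pow]
          gcongr
  have hzero : P {ω | ∀ n, ∃ l ∈ walkLists G n v, l.Nodup ∧ ∀ y ∈ l, τ y ω ∈ I} = 0 := by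
    refine le_antisymm (ge_of_tendsto' (ENNReal.tendsto_pow_atTop_nhds_zero_of_lt_one
      (r := 2⁻¹) (by simp)) fun n => ?_) zero_le
    refine le_trans (measure_mono ?_) (hbound n)
    intro ω hω
    exact hω n
  filter_upwards [measure_eq_zero_iff_ae_notMem.1 hzero] with ω hω
  simp only [not_forall, not_exists, not_and] at hω
  obtain ⟨n, hn⟩ := hω
  exact ⟨n, fun l hl hnd h => by
    obtain ⟨x, hx, hx'⟩ := hn l hl hnd
    exact hx' (h x hx)⟩

/-- The arrival times along an infinite descending path would converge, hence would eventually stay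
in an interval of any given length with a rational endpoint. -/
theorem IsArrivalTimes.ae_wellFounded [Countable V] (hτ : IsArrivalTimes P τ) {d : ℕ}
    (hd : ∀ v, G.degree v ≤ d) : ∀ᵐ ω ∂P, WellFounded (Precedes G fun v => τ v ω) := by
  set ε : ℝ := ((2 * (d + 1) : ℕ) : ℝ)⁻¹ with hε
  have hε0 : 0 < ε := by positivity
  have hall : ∀ᵐ ω ∂P, ∀ (v : V) (q : ℚ), ∃ n, ∀ l ∈ walkLists G n v, l.Nodup →
      ¬ ∀ y ∈ l, τ y ω ∈ Set.Ioo (q : ℝ) (q + ε) := by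
    rw [ae_all_iff]
    intro v
    rw [ae_all_iff]
    intro q
    refine hτ.ae_exists_forall_walkLists hd v measurableSet_Ioo ?_
    rw [Real.volume_Ioo, add_sub_cancel_left, hε, ENNReal.ofReal_inv_of_pos (by positivity),
      ENNReal.ofReal_natCast]
  filter_upwards [hall, hτ.ae_mem_Ioo] with ω hω hmem
  rw [wellFounded_iff_isEmpty_descending_chain]
  refine ⟨fun ⟨f, hf⟩ => ?_⟩
  have hanti : StrictAnti fun i => τ (f i) ω := strictAnti_nat_of_succ_lt fun i => (hf i).2
  have hinj : Function.Injective f := fun i j h => hanti.injective (congrArg (τ · ω) h)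
  have hbdd : BddBelow (Set.range fun i => τ (f i) ω) :=
    ⟨0, by rintro _ ⟨i, rfl⟩; exact (hmem (f i)).1.le⟩
  have hlim := tendsto_atTop_ciInf hanti.antitone hbdd
  set L := ⨅ i, τ (f i) ω
  obtain ⟨q, hq1, hq2⟩ := exists_rat_btwn (show L - ε < L by linarith)
  obtain ⟨m, hm⟩ := eventually_atTop.1
    (hlim.eventually (Ioo_mem_nhds hq2 (show L < q + ε by linarith)))
  obtain ⟨n, hn⟩ := hω (f m) q
  obtain ⟨l, hl, hnd, hmem'⟩ := exists_mem_walkLists hinj (fun i => (hf i).1) n m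
  refine hn l hl hnd fun y hy => ?_
  obtain ⟨i, hi, rfl⟩ := hmem' y hy
  exact hm i hi

end WellFounded

/-! ### The integral recursion for the vacancy probabilities -/

section Recursion

variable {V : Type*} {G : SimpleGraph V} [G.LocallyFinite]
  {Ω : Type*} {τ : V → Ω → ℝ}

/-- The σ-algebra generated by the arrival times at the vertices of `S`. -/
abbrev arrivalSigma (τ : V → Ω → ℝ) (S : Set V) : MeasurableSpace Ω :=
  ⨆ y ∈ S, MeasurableSpace.comap (τ y) inferInstance

theorem arrivalSigma_mono {S T : Set V} (h : S ⊆ T) : arrivalSigma τ S ≤ arrivalSigma τ T :=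
  biSup_mono h

theorem measurable_arrivalSigma {S : Set V} {y : V} (hy : y ∈ S) :
    Measurable[arrivalSigma τ S] (τ y) :=
  (comap_measurable (τ y)).mono
    (le_iSup₂_of_le (f := fun y (_ : y ∈ S) => MeasurableSpace.comap (τ y) inferInstance) y hy
      le_rfl) le_rfl

/-- `occTime n w` depends only on the arrival times in the branch at `w`. -/
theorem measurable_occTime (hG : G.IsTree) (o : V) (n : ℕ) (w : V) :
    Measurable[arrivalSigma τ (branch G o w)]
      (fun ω => occTime G o (fun v => τ v ω) n w) := by
  induction n generalizing w with
  | zero => exact measurable_const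
  | succ n ih =>
    have hself := measurable_arrivalSigma (τ := τ) (self_mem_branch (G := G) o w)
    simp only [occTime]
    refine Measurable.ite ?_ hself measurable_const
    have hset : {ω | ∀ x ∈ children G o w, τ w ω ≤ occTime G o (fun v => τ v ω) n x} =
        ⋂ x ∈ children G o w, {ω | τ w ω ≤ occTime G o (fun v => τ v ω) n x} := by
      ext ω
      simp
    rw [hset]
    refine Finset.measurableSet_biInter _ fun x hx => ?_
    exact measurableSet_le hself
      ((ih x).mono (arrivalSigma_mono (branch_subset_of_mem_children hG hx)) le_rfl)

variable [mΩ : MeasurableSpace Ω] {P : Measure Ω}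

theorem IsArrivalTimes.arrivalSigma_le (hτ : IsArrivalTimes P τ) (S : Set V) :
    arrivalSigma τ S ≤ mΩ :=
  iSup₂_le fun y _ => (hτ.measurable y).comap_le

theorem IsArrivalTimes.indep_arrivalSigma (hτ : IsArrivalTimes P τ) {S T : Set V}
    (h : Disjoint S T) : Indep (arrivalSigma τ S) (arrivalSigma τ T) P :=
  indep_iSup_of_disjoint (fun y => (hτ.measurable y).comap_le) hτ.indep h

theorem IsArrivalTimes.measurable_occTime (hτ : IsArrivalTimes P τ) (hG : G.IsTree) (o : V)
    (n : ℕ) (w : V) : Measurable (fun ω => occTime G o (fun v => τ v ω) n w) :=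
  (BlockingRSA.measurable_occTime hG o n w).mono (hτ.arrivalSigma_le _) le_rfl

variable [IsProbabilityMeasure P]

/-- The branches at the children of `w` evolve independently. -/
theorem IsArrivalTimes.measureReal_forall_le_occTime (hτ : IsArrivalTimes P τ) (hG : G.IsTree)
    (o : V) (n : ℕ) (w : V) (s : ℝ) :
    P.real {ω | ∀ x ∈ children G o w, s ≤ occTime G o (fun v => τ v ω) n x} =
      ∏ x ∈ children G o w, P.real {ω | s ≤ occTime G o (fun v => τ v ω) n x} := by
  classical
  suffices h : ∀ F ⊆ children G o w,
      P.real {ω | ∀ x ∈ F, s ≤ occTime G o (fun v => τ v ω) n x} =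
        ∏ x ∈ F, P.real {ω | s ≤ occTime G o (fun v => τ v ω) n x} from h _ subset_rfl
  intro F
  induction F using Finset.induction_on with
  | empty => simp
  | insert x F hx ih =>
    intro hF
    have hxc := hF (Finset.mem_insert_self x F)
    have hFc := (Finset.subset_insert x F).trans hF
    rw [Finset.prod_insert hx, ← ih hFc]
    have hset : {ω | ∀ y ∈ insert x F, s ≤ occTime G o (fun v => τ v ω) n y} =
        {ω | s ≤ occTime G o (fun v => τ v ω) n x} ∩
          {ω | ∀ y ∈ F, s ≤ occTime G o (fun v => τ v ω) n y} := by
      ext ω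
      simp
    -- The other branches lie in the complement of the branch at `x`.
    have hind := hτ.indep_arrivalSigma (disjoint_compl_right (a := branch G o x))
    have h1 : MeasurableSet[arrivalSigma τ (branch G o x)]
        {ω | s ≤ occTime G o (fun v => τ v ω) n x} :=
      BlockingRSA.measurable_occTime hG o n x measurableSet_Ici
    have h2 : MeasurableSet[arrivalSigma τ (branch G o x)ᶜ]
        {ω | ∀ y ∈ F, s ≤ occTime G o (fun v => τ v ω) n y} := by
      have hset' : {ω | ∀ y ∈ F, s ≤ occTime G o (fun v => τ v ω) n y} =
          ⋂ y ∈ F, {ω | s ≤ occTime G o (fun v => τ v ω) n y} := by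
        ext ω
        simp
      rw [hset']
      refine Finset.measurableSet_biInter _ fun y hy => ?_
      refine arrivalSigma_mono (Set.subset_compl_iff_disjoint_right.2 ?_) _
        (BlockingRSA.measurable_occTime hG o n y measurableSet_Ici)
      exact disjoint_branch hG (hFc hy) hxc (ne_of_mem_of_not_mem hy hx)
    rw [hset, measureReal_def, (Indep_iff _ _ P).1 hind _ _ h1 h2, ENNReal.toReal_mul]
    rfl

/-- Conditioning on the arrival time at `w`. -/
theorem IsArrivalTimes.measureReal_le_occTime_succ (hτ : IsArrivalTimes P τ) (hG : G.IsTree)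
    (o : V) (n : ℕ) (w : V) {t : ℝ} (ht : t ∈ Set.Icc (0 : ℝ) 1) :
    P.real {ω | t ≤ occTime G o (fun v => τ v ω) (n + 1) w} =
      1 - ∫ s in (0 : ℝ)..t,
        ∏ x ∈ children G o w, P.real {ω | s ≤ occTime G o (fun v => τ v ω) n x} := by
  set Z : Ω → (children G o w → ℝ) := fun ω x => occTime G o (fun v => τ v ω) n x with hZ
  set S : Set (ℝ × (children G o w → ℝ)) := {p | p.1 < t ∧ ∀ x, p.1 ≤ p.2 x} with hS
  have hZm : Measurable Z := measurable_pi_lambda _ fun x => hτ.measurable_occTime hG o n x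
  have hSm : MeasurableSet S := by
    have : S = {p | p.1 < t} ∩ ⋂ x, {p | p.1 ≤ p.2 x} := by
      ext p
      simp [hS]
    rw [this]
    exact (measurableSet_lt measurable_fst measurable_const).inter
      (MeasurableSet.iInter fun x => measurableSet_le measurable_fst
        ((measurable_pi_apply x).comp measurable_snd))
  have hind : IndepFun (τ w) Z P := by
    have h := hτ.indep_arrivalSigma (disjoint_compl_right (a := ({w} : Set V)))
    rw [IndepFun_iff_Indep]
    refine indep_of_indep_of_le_left (indep_of_indep_of_le_right h ?_) ?_
    · refine (@measurable_pi_lambda _ _ _ (arrivalSigma τ {w}ᶜ) _ Z fun x => ?_).comap_le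
      refine (BlockingRSA.measurable_occTime hG o n x.1).mono (arrivalSigma_mono ?_) le_rfl
      rintro y hy rfl
      exact notMem_branch_of_mem_children x.2 hy
    · exact (measurable_arrivalSigma (Set.mem_singleton w)).comap_le
  have hlaw := (indepFun_iff_map_prod_eq_prod_map_map (hτ.measurable w).aemeasurable
    hZm.aemeasurable).1 hind
  -- The site `w` is occupied before `t` when its particle arrives before `t` and no child is
  -- occupied by then.
  have hcompl : {ω | t ≤ occTime G o (fun v => τ v ω) (n + 1) w} =
      ((fun ω => (τ w ω, Z ω)) ⁻¹' S)ᶜ := by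
    ext ω
    simp only [Set.mem_ofPred_eq, occTime, Set.mem_compl_iff, Set.mem_preimage, hS, hZ,
      Subtype.forall]
    split_ifs with h
    · exact ⟨fun h1 h2 => not_lt.2 h1 h2.1, fun h1 => not_lt.1 fun h2 => h1 ⟨h2, h⟩⟩
    · exact ⟨fun _ h2 => h h2.2, fun _ => by linarith [ht.2]⟩
  have hpair : Measurable fun ω => (τ w ω, Z ω) := (hτ.measurable w).prodMk hZm
  rw [hcompl, probReal_compl_eq_one_sub (hpair hSm)]
  congr 1
  rw [measureReal_def, ← Measure.map_apply hpair hSm, hlaw, Measure.prod_apply hSm, hτ.map_eq]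
  have hslice : ∀ s, (P.map Z) (Prod.mk s ⁻¹' S) = (Set.Iio t).indicator (fun s =>
      P {ω | ∀ x ∈ children G o w, s ≤ occTime G o (fun v => τ v ω) n x}) s := by
    intro s
    rw [Measure.map_apply hZm (measurable_prodMk_left hSm)]
    by_cases hs : s < t
    · rw [Set.indicator_of_mem (Set.mem_Iio.2 hs)]
      congr 1
      ext ω
      simp [hS, hZ, hs]
    · rw [Set.indicator_of_notMem (by simpa using hs)]
      convert measure_empty (μ := P)
      ext ω
      simp [hS, hs]
  have hm : Measurable fun s =>
      P {ω | ∀ x ∈ children G o w, s ≤ occTime G o (fun v => τ v ω) n x} := by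
    refine Antitone.measurable fun a b hab => measure_mono fun ω h x hx => hab.trans (h x hx)
  simp_rw [hslice]
  rw [lintegral_indicator measurableSet_Iio, Measure.restrict_restrict measurableSet_Iio,
    ← integral_toReal hm.aemeasurable (ae_of_all _ fun _ => measure_lt_top _ _),
    intervalIntegral.integral_of_le ht.1, ← restrict_Ioo_eq_restrict_Ioc]
  have hIoo : Set.Iio t ∩ Set.Ioo 0 1 = Set.Ioo 0 t := by
    ext s
    simp only [Set.mem_inter_iff, Set.mem_Iio, Set.mem_Ioo]
    constructor
    · exact fun h => ⟨h.2.1, h.1⟩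
    · exact fun h => ⟨h.2, h.1, h.2.trans_le ht.2⟩
  rw [hIoo]
  refine integral_congr_ae (ae_of_all _ fun s => ?_)
  exact hτ.measureReal_forall_le_occTime hG o n w s

end Recursion

/-! ### The limit of the Picard iterates -/

section Analysis

/-- The explicit vacancy probability at the root of `T_k^*`. -/
noncomputable def rootVacancy (k : ℕ) (t : ℝ) : ℝ :=
  if k = 1 then Real.exp (-t) else (1 + ((k : ℝ) - 1) * t) ^ (-1 / ((k : ℝ) - 1))

theorem rootVacancy_zero (k : ℕ) : rootVacancy k 0 = 1 := by
  simp [rootVacancy]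

theorem rootVacancy_nonneg {k : ℕ} (hk : 1 ≤ k) {t : ℝ} (ht : 0 ≤ t) : 0 ≤ rootVacancy k t := by
  have hk' : (1 : ℝ) ≤ k := by exact_mod_cast hk
  unfold rootVacancy
  split_ifs
  · positivity
  · have := mul_nonneg (sub_nonneg.2 hk') ht
    positivity

/-- `rootVacancy k` solves the differential equation `h' = -h ^ k`. -/
theorem hasDerivAt_rootVacancy {k : ℕ} (hk : 1 ≤ k) {t : ℝ} (ht : 0 ≤ t) :
    HasDerivAt (rootVacancy k) (-(rootVacancy k t) ^ k) t := by
  unfold rootVacancy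
  by_cases h1 : k = 1
  · subst h1
    simpa using (hasDerivAt_neg t).exp
  · simp only [h1, if_false]
    have hk' : (0 : ℝ) < (k : ℝ) - 1 := by
      have : (1 : ℝ) < k := by exact_mod_cast (by omega : 1 < k)
      linarith
    have hpos : 0 < 1 + ((k : ℝ) - 1) * t := by positivity
    have hd : HasDerivAt (fun t : ℝ => 1 + ((k : ℝ) - 1) * t) ((k : ℝ) - 1) t := by
      simpa using ((hasDerivAt_id t).const_mul ((k : ℝ) - 1)).const_add 1
    convert hd.rpow_const (p := -1 / ((k : ℝ) - 1)) (Or.inl hpos.ne') using 1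
    rw [← Real.rpow_natCast, ← Real.rpow_mul hpos.le]
    have he : -1 / ((k : ℝ) - 1) * (k : ℝ) = -1 / ((k : ℝ) - 1) - 1 := by
      field_simp
      ring
    rw [he]
    field_simp

theorem continuousOn_rootVacancy {k : ℕ} (hk : 1 ≤ k) :
    ContinuousOn (rootVacancy k) (Set.Ici 0) :=
  fun _ ht => (hasDerivAt_rootVacancy hk ht).continuousAt.continuousWithinAt

theorem intervalIntegrable_rootVacancy_pow {k : ℕ} (hk : 1 ≤ k) (d : ℕ) {t : ℝ} (ht : 0 ≤ t) :
    IntervalIntegrable (fun s => rootVacancy k s ^ d) volume 0 t := by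
  refine ContinuousOn.intervalIntegrable ?_
  rw [Set.uIcc_of_le ht]
  exact ((continuousOn_rootVacancy hk).mono Set.Icc_subset_Ici_self).pow d

theorem rootVacancy_eq {k : ℕ} (hk : 1 ≤ k) {t : ℝ} (ht : 0 ≤ t) :
    rootVacancy k t = 1 - ∫ s in (0 : ℝ)..t, rootVacancy k s ^ k := by
  have h := intervalIntegral.integral_eq_sub_of_hasDerivAt (f := rootVacancy k)
    (f' := fun s => -(rootVacancy k s) ^ k) (a := 0) (b := t)
    (fun s hs => hasDerivAt_rootVacancy hk (by rw [Set.uIcc_of_le ht] at hs; exact hs.1))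
    (intervalIntegrable_rootVacancy_pow hk k ht).neg
  rw [intervalIntegral.integral_neg, rootVacancy_zero] at h
  linarith

/-- The derivative of `h ^ 2 / 2` is `h * h' = -h ^ (k + 1)`. -/
theorem half_one_add_rootVacancy_sq {k : ℕ} (hk : 1 ≤ k) {t : ℝ} (ht : 0 ≤ t) :
    1 / 2 * (1 + rootVacancy k t ^ 2) = 1 - ∫ s in (0 : ℝ)..t, rootVacancy k s ^ (k + 1) := by
  have h := intervalIntegral.integral_eq_sub_of_hasDerivAt
    (f := fun s => -(1 / 2 * rootVacancy k s ^ 2))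
    (f' := fun s => (rootVacancy k s) ^ (k + 1)) (a := 0) (b := t)
    (fun s hs => by
      have hs0 : 0 ≤ s := by rw [Set.uIcc_of_le ht] at hs; exact hs.1
      have hd := (((hasDerivAt_rootVacancy hk hs0).fun_pow 2).const_mul (1 / 2)).fun_neg
      have he : -(1 / 2 * (((2 : ℕ) : ℝ) * rootVacancy k s ^ (2 - 1) * -rootVacancy k s ^ k)) =
          rootVacancy k s ^ (k + 1) := by
        rw [pow_succ]
        norm_num
        ring
      rwa [he] at hd)
    (intervalIntegrable_rootVacancy_pow hk (k + 1) ht)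
  rw [rootVacancy_zero] at h
  linarith

theorem rootVacancy_le_one {k : ℕ} (hk : 1 ≤ k) {t : ℝ} (ht : 0 ≤ t) : rootVacancy k t ≤ 1 := by
  rw [rootVacancy_eq hk ht]
  have : 0 ≤ ∫ s in (0 : ℝ)..t, rootVacancy k s ^ k :=
    intervalIntegral.integral_nonneg ht fun s hs => pow_nonneg (rootVacancy_nonneg hk hs.1) k
  linarith

/-- The Picard iterates of `h t = 1 - ∫₀ᵗ h ^ k`: the vacancy probabilities at the root of the
first `n` generations of `T_k^*`. -/
noncomputable def picard (k : ℕ) : ℕ → ℝ → ℝ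
  | 0, _ => 1
  | n + 1, t => 1 - ∫ s in (0 : ℝ)..t, picard k n s ^ k

theorem continuous_picard (k n : ℕ) : Continuous (picard k n) := by
  cases n with
  | zero => exact continuous_const
  | succ n =>
    have ih := continuous_picard k n
    exact continuous_const.sub
      (intervalIntegral.continuous_primitive (fun a b => (ih.pow k).intervalIntegrable a b) 0)

theorem picard_mem_Icc (k n : ℕ) {t : ℝ} (ht : t ∈ Set.Icc (0 : ℝ) 1) :
    picard k n t ∈ Set.Icc (0 : ℝ) 1 := by
  induction n generalizing t with
  | zero => simp [picard]
  | succ n ih =>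
    have hint := ((continuous_picard k n).pow k).intervalIntegrable (μ := volume) 0 t
    have hmem : ∀ s ∈ Set.Icc 0 t, picard k n s ∈ Set.Icc (0 : ℝ) 1 :=
      fun s hs => ih ⟨hs.1, hs.2.trans ht.2⟩
    have h0 : 0 ≤ ∫ s in (0 : ℝ)..t, picard k n s ^ k :=
      intervalIntegral.integral_nonneg ht.1 fun s hs => pow_nonneg (hmem s hs).1 k
    have h1 : ∫ s in (0 : ℝ)..t, picard k n s ^ k ≤ ∫ s in (0 : ℝ)..t, (1 : ℝ) :=
      intervalIntegral.integral_mono_on ht.1 hint (by simp)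
        fun s hs => pow_le_one₀ (hmem s hs).1 (hmem s hs).2
    simp only [intervalIntegral.integral_const, sub_zero, smul_eq_mul, mul_one] at h1
    rw [picard]
    constructor <;> linarith [ht.2]

theorem abs_pow_sub_pow_le_mul {a b : ℝ} (ha : a ∈ Set.Icc (0 : ℝ) 1)
    (hb : b ∈ Set.Icc (0 : ℝ) 1) (d : ℕ) : |a ^ d - b ^ d| ≤ d * |a - b| := by
  have h := abs_pow_sub_pow_le a b d
  refine h.trans ?_
  have hmax : max |a| |b| ^ (d - 1) ≤ 1 := by
    refine pow_le_one₀ (le_max_of_le_left (abs_nonneg a)) (max_le ?_ ?_)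
    · rw [abs_of_nonneg ha.1]; exact ha.2
    · rw [abs_of_nonneg hb.1]; exact hb.2
  nlinarith [mul_nonneg (Nat.cast_nonneg (α := ℝ) d) (abs_nonneg (a - b))]

theorem abs_integral_pow_sub_le {k : ℕ} (hk : 1 ≤ k) (d n : ℕ) {t : ℝ}
    (ht : t ∈ Set.Icc (0 : ℝ) 1) {g : ℝ → ℝ} (hg : Continuous g)
    (h : ∀ s ∈ Set.Icc 0 t, |picard k n s - rootVacancy k s| ≤ g s) :
    |(∫ s in (0 : ℝ)..t, picard k n s ^ d) - ∫ s in (0 : ℝ)..t, rootVacancy k s ^ d| ≤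
      d * ∫ s in (0 : ℝ)..t, g s := by
  rw [← intervalIntegral.integral_sub
    (Continuous.intervalIntegrable (u := fun s => picard k n s ^ d)
      ((continuous_picard k n).pow d) 0 t)
    (intervalIntegrable_rootVacancy_pow hk d ht.1), ← intervalIntegral.integral_const_mul,
    ← Real.norm_eq_abs]
  refine intervalIntegral.norm_integral_le_of_norm_le ht.1 (ae_of_all _ fun s hs => ?_)
    ((continuous_const.mul hg).intervalIntegrable 0 t)
  rw [Real.norm_eq_abs]
  have hs0 : 0 ≤ s := hs.1.le
  refine (abs_pow_sub_pow_le_mul (picard_mem_Icc k n ⟨hs0, hs.2.trans ht.2⟩)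
    ⟨rootVacancy_nonneg hk hs0, rootVacancy_le_one hk hs0⟩ d).trans ?_
  exact mul_le_mul_of_nonneg_left (h s ⟨hs0, hs.2⟩) (Nat.cast_nonneg d)

open Nat in
theorem abs_picard_sub_rootVacancy_le {k : ℕ} (hk : 1 ≤ k) (n : ℕ) {t : ℝ}
    (ht : t ∈ Set.Icc (0 : ℝ) 1) :
    |picard k n t - rootVacancy k t| ≤ (k * t) ^ n / (n ! : ℝ) := by
  induction n generalizing t with
  | zero =>
    have h0 := rootVacancy_nonneg hk ht.1
    have h1 := rootVacancy_le_one hk ht.1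
    simp only [picard, pow_zero, Nat.factorial_zero, Nat.cast_one, div_one]
    rw [abs_le]
    constructor <;> linarith
  | succ n ih =>
    have h := abs_integral_pow_sub_le hk k n ht (g := fun s => (k * s) ^ n / (n ! : ℝ))
      (by fun_prop) fun s hs => ih ⟨hs.1, hs.2.trans ht.2⟩
    rw [picard, rootVacancy_eq hk ht.1, sub_sub_sub_cancel_left, abs_sub_comm]
    refine h.trans (le_of_eq ?_)
    have hi : ∫ s in (0 : ℝ)..t, ((k : ℝ) * s) ^ n / (n ! : ℝ) =
        (k : ℝ) ^ n / (n ! : ℝ) * (t ^ (n + 1) / (n + 1)) := by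
      rw [show (fun s : ℝ => ((k : ℝ) * s) ^ n / (n ! : ℝ)) =
        fun s => (k : ℝ) ^ n / (n ! : ℝ) * s ^ n by ext s; rw [mul_pow]; ring,
        intervalIntegral.integral_const_mul, integral_pow]
      simp
    rw [hi, Nat.factorial_succ, mul_pow, pow_succ' (k : ℝ)]
    push_cast
    field_simp

theorem tendsto_integral_picard_pow {k : ℕ} (hk : 1 ≤ k) (d : ℕ) {t : ℝ}
    (ht : t ∈ Set.Icc (0 : ℝ) 1) :
    Tendsto (fun n => 1 - ∫ s in (0 : ℝ)..t, picard k n s ^ d) atTop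
      (𝓝 (1 - ∫ s in (0 : ℝ)..t, rootVacancy k s ^ d)) := by
  refine tendsto_const_nhds.sub ?_
  rw [tendsto_iff_dist_tendsto_zero]
  have hlim := (FloorSemiring.tendsto_pow_div_factorial_atTop (k : ℝ)).const_mul (d * t)
  rw [mul_zero] at hlim
  refine squeeze_zero (fun _ => dist_nonneg) (fun n => ?_) hlim
  rw [Real.dist_eq]
  have h := abs_integral_pow_sub_le hk d n ht (g := fun _ => (k : ℝ) ^ n / (n.factorial : ℝ))
    continuous_const fun s hs => by
      refine (abs_picard_sub_rootVacancy_le hk n ⟨hs.1, hs.2.trans ht.2⟩).trans ?_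
      have : (k : ℝ) * s ≤ k :=
        mul_le_of_le_one_right (Nat.cast_nonneg k) (hs.2.trans ht.2)
      have h0 : 0 ≤ (k : ℝ) * s := mul_nonneg (Nat.cast_nonneg k) hs.1
      gcongr
  refine h.trans (le_of_eq ?_)
  simp
  ring

end Analysis

/-! ### The vacancy probability at the root -/

section Main

variable {V : Type*} {G : SimpleGraph V} [G.LocallyFinite]
  {Ω : Type*} [MeasurableSpace Ω] {P : Measure Ω} [IsProbabilityMeasure P] {τ : V → Ω → ℝ}

/-- Every vertex other than the root has `k` children, so all of them satisfy the recursion of the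
Picard iterates. -/
theorem IsArrivalTimes.measureReal_le_occTime_eq_picard (hτ : IsArrivalTimes P τ) (hG : G.IsTree)
    {k : ℕ} {o : V} (hdeg : ∀ w, w ≠ o → G.degree w = k + 1) (n : ℕ) {w : V} (hw : w ≠ o)
    {t : ℝ} (ht : t ∈ Set.Icc (0 : ℝ) 1) :
    P.real {ω | t ≤ occTime G o (fun v => τ v ω) n w} = picard k n t := by
  induction n generalizing w t with
  | zero =>
    have : {ω | t ≤ occTime G o (fun v => τ v ω) 0 w} = Set.univ := by
      ext ω
      simp only [occTime, Set.mem_ofPred_eq, Set.mem_univ, iff_true]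
      linarith [ht.2]
    rw [this, probReal_univ, picard]
  | succ n ih =>
    rw [hτ.measureReal_le_occTime_succ hG o n w ht, picard]
    congr 1
    refine intervalIntegral.integral_congr fun s hs => ?_
    rw [Set.uIcc_of_le ht.1] at hs
    have hcard : (children G o w).card = k := by
      have := card_children_add_one hG hw
      rw [hdeg w hw] at this
      omega
    rw [← hcard]
    refine Finset.prod_eq_pow_card fun x hx => ?_
    rw [hcard]
    refine ih ?_ ⟨hs.1, hs.2.trans ht.2⟩
    rintro rfl
    simpa using (mem_children.1 hx).2

/-- Vacancy at the root of a tree in which the other vertices have degree `k + 1`: the branches at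
the neighbours of the root are independent copies of `T_k^*`. -/
theorem IsArrivalTimes.vacancyProb_eq [Countable V] (hτ : IsArrivalTimes P τ) (hG : G.IsTree)
    {k : ℕ} (hk : 1 ≤ k) {o : V} (hdeg : ∀ w, w ≠ o → G.degree w = k + 1)
    (hwf : ∀ᵐ ω ∂P, WellFounded (Precedes G fun v => τ v ω))
    {t : ℝ} (ht : t ∈ Set.Icc (0 : ℝ) 1) :
    vacancyProb G P τ t o = 1 - ∫ s in (0 : ℝ)..t, rootVacancy k s ^ G.degree o := by
  have hconv : ∀ᵐ ω ∂P, ∀ᶠ n in atTop, (t ≤ occTime G o (fun v => τ v ω) n o ↔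
      state G (fun v => τ v ω) t o = 0) := by
    filter_upwards [hwf, hτ.ae_mem_Ioo, hτ.ae_ne o t] with ω h1 h2 h3
    exact eventually_le_occTime_iff hG h1 (fun v => (h2 v).2.trans one_lt_two) ht.2 h3
  have hmeas : ∀ n, MeasurableSet {ω | t ≤ occTime G o (fun v => τ v ω) n o} := fun n =>
    hτ.measurable_occTime hG o n o measurableSet_Ici
  have hlim : Tendsto (fun n => P.real {ω | t ≤ occTime G o (fun v => τ v ω) n o}) atTop
      (𝓝 (vacancyProb G P τ t o)) := by
    have hnull : NullMeasurableSet {ω | state G (fun v => τ v ω) t o = 0} P :=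
      nullMeasurableSet_of_tendsto_indicator atTop (fun n => (hmeas n).nullMeasurableSet) hconv
    -- The event is only null measurable; convergence is proved for a measurable version of it.
    have hae := measure_congr hnull.toMeasurable_ae_eq
    rw [vacancyProb, measureReal_def, ← hae]
    refine (ENNReal.tendsto_toReal (measure_ne_top P _)).comp
      (tendsto_measure_of_ae_tendsto_indicator_of_isFiniteMeasure atTop
        (measurableSet_toMeasurable _ _) hmeas ?_)
    filter_upwards [hconv, hnull.toMeasurable_ae_eq.mem_iff] with ω h1 h2
    filter_upwards [h1] with n hn
    exact hn.trans h2.symm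
  refine tendsto_nhds_unique ((tendsto_add_atTop_iff_nat 1).2 hlim) ?_
  refine (tendsto_integral_picard_pow hk (G.degree o) ht).congr fun n => ?_
  rw [hτ.measureReal_le_occTime_succ hG o n o ht]
  congr 1
  refine intervalIntegral.integral_congr fun s hs => ?_
  rw [Set.uIcc_of_le ht.1] at hs
  rw [children_root, ← G.card_neighborFinset_eq_degree o]
  refine (Finset.prod_eq_pow_card fun x hx => ?_).symm
  exact hτ.measureReal_le_occTime_eq_picard hG hdeg n
    (((G.mem_neighborFinset o x).1 hx).ne') ⟨hs.1, hs.2.trans ht.2⟩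

end Main

end BlockingRSA

theorem theorem12 (k : ℕ) (hk : 1 ≤ k)
    {V : Type*} [Countable V] (G : SimpleGraph V) [G.LocallyFinite]
    (hG : BlockingRSA.IsRegularTree k G)
    {U : Type*} [Countable U] (H : SimpleGraph U) [H.LocallyFinite] (r : U)
    (hH : BlockingRSA.IsRootedRegularTree k H r)
    {Ω : Type*} [MeasurableSpace Ω] (P : Measure Ω) [IsProbabilityMeasure P]
    (τ : V → Ω → ℝ) (hτ : BlockingRSA.IsArrivalTimes P τ)
    {Ω' : Type*} [MeasurableSpace Ω'] (P' : Measure Ω') [IsProbabilityMeasure P']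
    (σ : U → Ω' → ℝ) (hσ : BlockingRSA.IsArrivalTimes P' σ) :
    (∀ᵐ ω ∂P, BlockingRSA.IsWellDefined G (fun w => τ w ω)) ∧
    (∀ᵐ ω ∂P', BlockingRSA.IsWellDefined H (fun u => σ u ω)) ∧
    (∀ t ∈ Set.Icc (0 : ℝ) 1, ∀ v : V,
      BlockingRSA.vacancyProb G P τ t v =
        1 / 2 * (1 + BlockingRSA.vacancyProb H P' σ t r ^ 2)) ∧
    (∀ t ∈ Set.Icc (0 : ℝ) 1,
      BlockingRSA.vacancyProb H P' σ t r =
        if k = 1 then Real.exp (-t)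
        else (1 + ((k : ℝ) - 1) * t) ^ (-1 / ((k : ℝ) - 1))) ∧
    (∀ v : V,
      BlockingRSA.vacancyProb G P τ 1 v =
        if k = 1 then 1 / 2 * (1 + Real.exp (-2))
        else 1 / 2 * (1 + (k : ℝ) ^ (-2 / ((k : ℝ) - 1)))) := by
  have hdegV : ∀ v, G.degree v = k + 1 := fun v => hG.regular v
  have hdegU : ∀ u, H.degree u ≤ k + 1 := fun u => by
    by_cases hu : u = r
    · rw [hu, hH.degree_root]
      exact k.le_succ
    · exact (hH.degree_of_ne u hu).le
  have hwfG := hτ.ae_wellFounded (G := G) fun v => (hdegV v).le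
  have hwfH := hσ.ae_wellFounded hdegU
  have hroot : ∀ t ∈ Set.Icc (0 : ℝ) 1,
      BlockingRSA.vacancyProb H P' σ t r = BlockingRSA.rootVacancy k t := fun t ht => by
    rw [hσ.vacancyProb_eq hH.isTree hk hH.degree_of_ne hwfH ht, hH.degree_root,
      ← BlockingRSA.rootVacancy_eq hk ht.1]
  have hreg : ∀ t ∈ Set.Icc (0 : ℝ) 1, ∀ v,
      BlockingRSA.vacancyProb G P τ t v = 1 / 2 * (1 + BlockingRSA.rootVacancy k t ^ 2) :=
    fun t ht v => by
      rw [hτ.vacancyProb_eq hG.isTree hk (fun w _ => hdegV w) hwfG ht, hdegV,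
        BlockingRSA.half_one_add_rootVacancy_sq hk ht.1]
  refine ⟨?_, ?_, fun t ht v => ?_, fun t ht => hroot t ht, fun v => ?_⟩
  · filter_upwards [hwfG] with ω hω using BlockingRSA.isWellDefined_of_wellFounded hω
  · filter_upwards [hwfH] with ω hω using BlockingRSA.isWellDefined_of_wellFounded hω
  · rw [hreg t ht v, hroot t ht]
  · rw [hreg 1 ⟨zero_le_one, le_rfl⟩ v, BlockingRSA.rootVacancy]
    split_ifs with h1
    · rw [← Real.exp_nat_mul]
      norm_num
    · rw [mul_one, add_sub_cancel, ← Real.rpow_natCast, ← Real.rpow_mul (Nat.cast_nonneg k)]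
      congr 3
      push_cast
      ring
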